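/- All vector spaces are over $\mathbb{C}$; for a $\mathbb{C}[\partial]$-module $M$, a substitution such as $\lambda\mapsto-\partial-\lambda$ in an element of $M[\lambda]$ means that $\partial$ acts on the coefficients. **Algebras and representations.** A Nijenhuis Lie conformal algebra $L_N=(L,[\cdot_\lambda\cdot],N)$ is a $\mathbb{C}[\partial]$-module $L$ with a $\mathbb{C}$-bilinear map $[\cdot_\lambda\cdot]:L\otimes L\to L[\lambda]$ such that $[\partial p_\lambda q]=-\lambda[p_\lambda q]$, $[p_\lambda\partial q]=(\partial+\lambda)[p_\lambda q]$, $[p_\lambda q]=-[q_{-\partial-\lambda}p]$, $[p_\lambda[q_\mu r]]=[[p_\lambda q]_{\lambda+\mu}r]+[q_\mu[p_\lambda r]]$, and a $\mathbb{C}[\partial]$-linear map $N:L\to L$ with $[N(p)_\lambda N(q)]=N([p_\lambda q]_N)$, where $[p_\lambda q]_N=[N(p)_\lambda q]+[p_\lambda N(q)]-N([p_\lambda q])$. A Nijenhuis representation $M_Q=(M,\rho,Q)$ of $L_N$ is a $\mathbb{C}[\partial]$-module $M$ with a $\mathbb{C}$-bilinear map $L\otimes M\to M[\lambda]$, $p\otimes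 m\mapsto\rho(p)_\lambda m$, such that $\rho(\partial p)_\lambda m=-\lambda\rho(p)_\lambda m$, $\rho(p)_\lambda\partial m=(\partial+\lambda)\rho(p)_\lambda m$, $\rho([p_\lambda q])_{\lambda+\mu}m=\rho(p)_\lambda\rho(q)_\mu m-\rho(q)_\mu\rho(p)_\lambda m$, and a $\mathbb{C}[\partial]$-linear map $Q:M\to M$ with $\rho(N(p))_\lambda Q(m)=Q\big(\rho(N(p))_\lambda m+\rho(p)_\lambda Q(m)-Q(\rho(p)_\lambda m)\big)$. **Cohomology.** For $n\ge1$ let $C^n(L,M)$ be the space of $\mathbb{C}$-linear maps $f:L^{\otimes n}\to M[\lambda_1,\dots,\lambda_{n-1}]$ for which, with $\lambda_n:=-\partial-\lambda_1-\cdots-\lambda_{n-1}$, one has $f(\dots,\partial p_i,\dots)=-\lambda_i f(\dots,p_i,\dots)$ for $1\le i\le n$ and $f_{\lambda_1,\dots,\lambda_{n-1}}(p_1,\dots,p_n)=\operatorname{sgn}(\sigma)f_{\lambda_{\sigma(1)},\dots,\lambda_{\sigma(n-1)}}(p_{\sigma(1)},\dots,p_{\sigma(n)})$ for all $\sigma\in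 S_n$. Put $$(\delta f)(p_1,\dots,p_{n+1})=\sum_{i}(-1)^{i+1}\rho(p_i)_{\lambda_i}f(\dots,\hat p_i,\dots)+\sum_{i<j}(-1)^{i+j}f_{\lambda_i+\lambda_j,\dots}([{p_i}_{\lambda_i}p_j],\dots,\hat p_i,\dots,\hat p_j,\dots)$$ (now with $\lambda_{n+1}=-\partial-\lambda_1-\cdots-\lambda_n$; the remaining $\lambda$'s go with the remaining arguments). Let $d_{N,M}f$ be the same expression with $\rho(N(p_i))$ and $[\cdot_\lambda\cdot]_N$ instead of $\rho(p_i)$ and $[\cdot_\lambda\cdot]$, minus $Q(\delta f)$, and let $\xi^nf(p_1,\dots,p_n)=\sum_{S\subseteq\{1,\dots,n\}}(-1)^{|S|}Q^{|S|}f(u_1,\dots,u_n)$ with $u_i=p_i$ for $i\in S$ and $u_i=N(p_i)$ otherwise. For $n\ge2$ put $C^n_{NL}=C^n(L,M)\oplus C^{n-1}(L,M)$ and $d^n_{NL}(f,g)=(\delta f,(-1)^n\xi^nf+d_{N,M}g)$. Then $H^3_{NL}(L_N,M_Q)=\ker d^3_{NL}/\operatorname{im}d^2_{NL}$. **2-term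 Nijenhuis $L_\infty$-conformal algebras.** A 2-term $L_\infty$-conformal algebra consists of a $\mathbb{C}[\partial]$-linear map $d:L_1\to L_0$ of $\mathbb{C}[\partial]$-modules, $\mathbb{C}$-bilinear conformally sesquilinear maps $[\![\cdot_\lambda\cdot]\!]:L_i\otimes L_j\to L_{i+j}[\lambda]$ for $i+j\le1$ (the bracket of two elements of $L_1$ being $0$), and $l_3\in C^3(L_0,L_1)$, such that for $p,q,r,w\in L_0$ and $m,n\in L_1$: $[\![p_\lambda m]\!]=-[\![m_{-\partial-\lambda}p]\!]$; $[\![p_\lambda q]\!]=-[\![q_{-\partial-\lambda}p]\!]$; $d[\![p_\lambda m]\!]=[\![p_\lambda dm]\!]$; $[\![dm_\lambda n]\!]=[\![m_\lambda dn]\!]$; $d\,l_{3\,\lambda,\mu}(p,q,r)=[\![p_\lambda[\![q_\mu r]\!]]\!]-[\![[\![p_\lambda q]\!]_{\lambda+\mu}r]\!]-[\![q_\mu[\![p_\lambda r]\!]]\!]$; $l_{3\,\lambda,\mu}(p,q,dm)=[\![p_\lambda[\![q_\mu m]\!]]\!]-[\![[\![p_\lambda q]\!]_{\lambda+\mu}m]\!]-[\![q_\mu[\![p_\lambda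 m]\!]]\!]$; and $$\begin{aligned}&[\![p_\lambda l_{3\,\mu,\nu}(q,r,w)]\!]-[\![q_\mu l_{3\,\lambda,\nu}(p,r,w)]\!]+[\![r_\nu l_{3\,\lambda,\mu}(p,q,w)]\!]-[\![w_{-\partial-\lambda-\mu-\nu}l_{3\,\lambda,\mu}(p,q,r)]\!]\\&=l_{3\,\lambda+\mu,\nu}([\![p_\lambda q]\!],r,w)+l_{3\,\mu,\lambda+\nu}(q,[\![p_\lambda r]\!],w)+l_{3\,\mu,\nu}(q,r,[\![p_\lambda w]\!])\\&\quad-l_{3\,\lambda,\mu+\nu}(p,[\![q_\mu r]\!],w)-l_{3\,\lambda,\nu}(p,r,[\![q_\mu w]\!])+l_{3\,\lambda,\mu}(p,q,[\![r_\nu w]\!]).\end{aligned}$$ It is a 2-term Nijenhuis $L_\infty$-conformal algebra if it is equipped with $\mathbb{C}[\partial]$-linear maps $N_0:L_0\to L_0$, $N_1:L_1\to L_1$ and $N_2\in C^2(L_0,L_1)$ such that, writing $\{x_\lambda y\}=[\![Nx_\lambda y]\!]+[\![x_\lambda Ny]\!]-N[\![x_\lambda y]\!]$ (with $N=N_0$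 or $N_1$ according to the degree): $dN_1=N_0d$; $d\,N_{2\,\lambda}(p,q)=N_0\{p_\lambda q\}-[\![N_0p_\lambda N_0q]\!]$; $N_{2\,\lambda}(p,dm)=N_1\{p_\lambda m\}-[\![N_0p_\lambda N_1m]\!]$; and $$\begin{aligned}&[\![N_0p_\lambda N_{2\,\mu}(q,r)]\!]-[\![N_0q_\mu N_{2\,\lambda}(p,r)]\!]-[\![N_{2\,\lambda}(p,q)_{\lambda+\mu}N_0r]\!]-N_{2\,\lambda+\mu}(\{p_\lambda q\},r)+N_{2\,\lambda}(p,\{q_\mu r\})-N_{2\,\mu}(q,\{p_\lambda r\})\\&-N_1\Big([\![p_\lambda N_{2\,\mu}(q,r)]\!]-[\![q_\mu N_{2\,\lambda}(p,r)]\!]-[\![N_{2\,\lambda}(p,q)_{\lambda+\mu}r]\!]-N_{2\,\lambda+\mu}([\![p_\lambda q]\!],r)+N_{2\,\lambda}(p,[\![q_\mu r]\!])-N_{2\,\mu}(q,[\![p_\lambda r]\!])\Big)\\&=\sum_{S\subseteq\{1,2,3\}}(-1)^{|S|}N_1^{|S|}l_{3\,\lambda,\mu}(u_1,u_2,u_3),\end{aligned}$$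 where $(u_1,u_2,u_3)$ is $(p,q,r)$ with $N_0$ applied to the entries whose index is not in $S$. It is skeletal if $d=0$. Two skeletal 2-term Nijenhuis $L_\infty$-conformal algebras on the same $\mathbb{C}[\partial]$-modules $L_0,L_1$ are equivalent if they have the same brackets, the same $N_0$ and the same $N_1$, and $(l_3',N_2')=(l_3,N_2)+d^2_{NL}(f,\theta)$ for some $(f,\theta)\in C^2_{NL}=C^2(L_0,L_1)\oplus C^1(L_0,L_1)$, where $d^2_{NL}$ is taken for $(L_0,[\![\cdot_\lambda\cdot]\!],N_0)$ with coefficients in $(L_1,[\![\cdot_\lambda\cdot]\!],N_1)$. **Theorem.** Let $L_0$ and $L_1$ be $\mathbb{C}[\partial]$-modules. For every skeletal 2-term Nijenhuis $L_\infty$-conformal algebra on $L_0,L_1$, the triple $(L_0,[\![\cdot_\lambda\cdot]\!],N_0)$ is a Nijenhuis Lie conformal algebra, $(L_1,\rho,N_1)$ with $\rho(p)_\lambda m=[\![p_\lambda m]\!]$ is a Nijenhuis representation of it, and $(l_3,N_2)$ is a 3-cocycle. Sending such an algebra to these two structures and the class $[(l_3,N_2)]$ induces a bijection between the equivalence classes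 of skeletal 2-term Nijenhuis $L_\infty$-conformal algebras on $L_0,L_1$ and the triples $(L_N,M_Q,[(g,\tau)])$, where $L_N$ is a Nijenhuis Lie conformal algebra structure on $L_0$, $M_Q$ is a Nijenhuis representation of $L_N$ on $L_1$, and $[(g,\tau)]\in H^3_{NL}(L_N,M_Q)$. -/

import Mathlib

open scoped Polynomial

noncomputable section

/- A `ℂ[∂]`-module is a module over `ℂ[X]` whose `ℂ`-structure is the restricted one
(`IsScalarTower ℂ ℂ[X] M`); the operator `∂` is multiplication by `X`. -/

/-- `M[λ₁, …, λₖ]`, polynomials in `k` commuting variables with coefficients in `M`,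
given by their coefficients. -/
def LPoly (k : ℕ) (M : Type*) [AddCommGroup M] : Type _ := (Fin k →₀ ℕ) →₀ M

instance LPoly.addCommGroup (k : ℕ) (M : Type*) [AddCommGroup M] : AddCommGroup (LPoly k M) :=
  inferInstanceAs (AddCommGroup ((Fin k →₀ ℕ) →₀ M))

instance LPoly.module (k : ℕ) (M : Type*) [AddCommGroup M] [Module ℂ M] : Module ℂ (LPoly k M) :=
  inferInstanceAs (Module ℂ ((Fin k →₀ ℕ) →₀ M))

section Evaluation

variable {M : Type*} [AddCommGroup M] [Module ℂ M] [Module ℂ[X] M] [IsScalarTower ℂ ℂ[X] M]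

/-- Substitution `λᵢ ↦ Λᵢ` in an `M`-valued polynomial, where each `Λᵢ` is a polynomial in `∂`,
acting on the coefficients: `∑ₛ λˢ mₛ ↦ ∑ₛ Λˢ mₛ`.  For `Λᵢ ∈ ℂ` this is the evaluation at complex
numbers, and (`ℂ` being infinite) an `M`-valued polynomial is determined by these values, so
polynomial identities are stated for all complex values of the `λ`'s.  Substitutions such as
`λ ↦ -∂ - λ` are covered too. -/
def ev {k : ℕ} (Λ : Fin k → ℂ[X]) : LPoly k M →ₗ[ℂ] M :=
  (Finsupp.lsum ℂ fun s => Algebra.lsmul ℂ ℂ M (∏ i, Λ i ^ s i) :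
    ((Fin k →₀ ℕ) →₀ M) →ₗ[ℂ] M)

/-- The value `b(p)_Λ q` at `λ = Λ` of a `λ`-product `b : P ⊗ Q → M[λ]`. -/
def lam {P Q : Type*} [AddCommGroup P] [Module ℂ P] [AddCommGroup Q] [Module ℂ Q]
    (b : P →ₗ[ℂ] Q →ₗ[ℂ] LPoly 1 M) (Λ : ℂ[X]) : P →ₗ[ℂ] Q →ₗ[ℂ] M :=
  b.compr₂ (ev fun _ => Λ)

/-- Conformal sesquilinearity of a `λ`-product:
`(∂p)_λ q = -λ (p_λ q)` and `p_λ (∂q) = (∂ + λ) (p_λ q)`. -/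
def IsSesquilinear {P Q : Type*} [AddCommGroup P] [Module ℂ P] [Module ℂ[X] P]
    [AddCommGroup Q] [Module ℂ Q] [Module ℂ[X] Q]
    (b : P →ₗ[ℂ] Q →ₗ[ℂ] LPoly 1 M) : Prop :=
  ∀ (x : ℂ) (p : P) (q : Q),
    lam b (.C x) ((.X : ℂ[X]) • p) q = -(x • lam b (.C x) p q) ∧
    lam b (.C x) p ((.X : ℂ[X]) • q) = (.X + .C x : ℂ[X]) • lam b (.C x) p q

end Evaluation

/-- `(λ₁, …, λₖ, λₖ₊₁)` where `λₖ₊₁ = -∂ - λ₁ - ⋯ - λₖ`. -/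
def full {k : ℕ} (x : Fin k → ℂ) : Fin (k + 1) → ℂ[X] :=
  Fin.snoc (α := fun _ => ℂ[X]) (fun i => Polynomial.C (x i))
    (-Polynomial.X - ∑ i, Polynomial.C (x i))

section Cochains

variable (L M : Type*) [AddCommGroup L] [Module ℂ L] [Module ℂ[X] L]
  [AddCommGroup M] [Module ℂ M] [Module ℂ[X] M] [IsScalarTower ℂ ℂ[X] M]

/-- `ℂ`-multilinear maps `L^{⊗ (k+1)} → M[λ₁, …, λₖ]`. -/
abbrev PreCochain (k : ℕ) : Type _ := MultilinearMap ℂ (fun _ : Fin (k + 1) => L) (LPoly k M)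

/-- Conformal cochains of degree `k + 1`: the `ℂ`-multilinear maps `L^{⊗ (k+1)} → M[λ₁, …, λₖ]`
that are conformally sesquilinear (`∂` in slot `i ≤ k` acts as `-λᵢ`, and in the last slot as
`∂ + λ₁ + ⋯ + λₖ = -λₖ₊₁`) and conformally skew-symmetric
(`f_{λ₁,…,λₖ}(p₁, …, pₖ₊₁) = sgn(σ) f_{λ_σ(1),…,λ_σ(k)}(p_σ(1), …, p_σ(k+1))`
with `λₖ₊₁ = -∂ - λ₁ - ⋯ - λₖ`). -/
def cochains (k : ℕ) : Submodule ℂ (PreCochain L M k) where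
  carrier := {f |
    (∀ (x : Fin k → ℂ) (p : Fin (k + 1) → L) (i : Fin (k + 1)),
      ev (fun j => .C (x j)) (f (Function.update p i ((.X : ℂ[X]) • p i))) =
        -(full x i • ev (fun j => .C (x j)) (f p))) ∧
    (∀ (x : Fin k → ℂ) (p : Fin (k + 1) → L) (σ : Equiv.Perm (Fin (k + 1))),
      ev (fun j => .C (x j)) (f p) =
        (Equiv.Perm.sign σ : ℤ) • ev (Fin.init (full x ∘ σ)) (f (p ∘ σ)))}
  zero_mem' := by constructor <;> intros <;> simp
  add_mem' := by
    rintro f g ⟨hf, hf'⟩ ⟨hg, hg'⟩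
    refine ⟨fun x p i => ?_, fun x p σ => ?_⟩
    · simp only [add_apply, map_add, hf x p i, hg x p i, smul_add, neg_add]
    · simp only [add_apply, map_add, smul_add, ← hf' x p σ, ← hg' x p σ]
  smul_mem' := by
    rintro c f ⟨hf, hf'⟩
    refine ⟨fun x p i => ?_, fun x p σ => ?_⟩
    · simp only [smul_apply, map_smul, hf x p i, smul_neg, smul_comm c]
    · simp only [smul_apply, map_smul, smul_comm _ c, ← hf' x p σ]

/-- Functions of `λ₁, …, λₖ ∈ ℂ` and `p₁, …, pₖ₊₁ ∈ L`: cochains of degree `k + 1` are regarded as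
such functions through `values`. -/
abbrev CochainFun (k : ℕ) : Type _ := (Fin k → ℂ) → (Fin (k + 1) → L) → M

variable {L M}

/-- The values `f_{λ₁,…,λₖ}(p₁, …, pₖ₊₁)` at complex `λ`'s. -/
def values (k : ℕ) : PreCochain L M k →ₗ[ℂ] CochainFun L M k where
  toFun f x p := ev (fun j => .C (x j)) (f p)
  map_add' f g := by ext; simp
  map_smul' c f := by ext; simp

/-- The Chevalley–Eilenberg formula for an action `a : (Λ, p) ↦ a(p)_Λ` and a bracket
`b : (λ, p, q) ↦ b(p_λ q)`:
`∑ᵢ (-1)^{i+1} a(pᵢ)_{λᵢ} f_{…,λ̂ᵢ,…}(…, p̂ᵢ, …)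
  + ∑_{i<j} (-1)^{i+j} f_{λᵢ+λⱼ,…,λ̂ᵢ,…,λ̂ⱼ,…}(b(pᵢ_{λᵢ} pⱼ), …, p̂ᵢ, …, p̂ⱼ, …)`,
where the last `λ` of the arguments is `-∂ -` (the sum of the others), and the last `λ` is not
written as a subscript of `f` (`Fin.init` drops it).  The pairs `i < j` are indexed by `j` and by
`i` with `i.castSucc < j`. -/
def chevalleyEilenberg (a : ℂ[X] → L → M →ₗ[ℂ] M) (b : ℂ → L → L → L) (k : ℕ) :
    PreCochain L M k →ₗ[ℂ] CochainFun L M (k + 1) where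
  toFun f x p :=
    (∑ i : Fin (k + 2), (-1 : ℤ) ^ (i : ℕ) •
      a (full x i) (p i) (ev (Fin.init (full x ∘ i.succAbove)) (f (p ∘ i.succAbove)))) +
    ∑ j : Fin (k + 2), ∑ i : Fin (k + 1),
      if i.castSucc < j then
        (-1 : ℤ) ^ ((i : ℕ) + (j : ℕ)) •
          ev (Fin.init (α := fun _ => ℂ[X])
              (Fin.cons (full x i.castSucc + full x j) (full x ∘ j.succAbove ∘ i.succAbove)))
            (f (Fin.cons (b (x i) (p i.castSucc) (p j)) (p ∘ j.succAbove ∘ i.succAbove)))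
      else 0
  map_add' f g := by
    ext x p
    simp only [add_apply, map_add, smul_add, Finset.sum_add_distrib, Pi.add_apply, ite_add_zero]
    rw [add_add_add_comm]
  map_smul' c f := by
    ext x p
    simp only [smul_apply, map_smul, smul_comm _ c, Pi.smul_apply, RingHom.id_apply,
      smul_add, Finset.smul_sum, smul_ite, smul_zero]

variable [IsScalarTower ℂ ℂ[X] L]

/-- The bracket `[p_λ q]_N = [N(p)_λ q] + [p_λ N(q)] - N([p_λ q])`. -/
def nijBracket (br : L →ₗ[ℂ] L →ₗ[ℂ] LPoly 1 L) (N : L →ₗ[ℂ[X]] L) (x : ℂ) (p q : L) : L :=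
  lam br (.C x) (N p) q + lam br (.C x) p (N q) - N (lam br (.C x) p q)

/-- The coboundary `δ` of the Lie conformal algebra `L` with coefficients in `M`. -/
def delta (br : L →ₗ[ℂ] L →ₗ[ℂ] LPoly 1 L) (ρ : L →ₗ[ℂ] M →ₗ[ℂ] LPoly 1 M) (k : ℕ) :
    PreCochain L M k →ₗ[ℂ] CochainFun L M (k + 1) :=
  chevalleyEilenberg (fun Λ p => lam ρ Λ p) (fun x p q => lam br (.C x) p q) k

/-- Composition with an operator `Q` on the values. -/
def postComp (Q : M →ₗ[ℂ[X]] M) (k : ℕ) : CochainFun L M k →ₗ[ℂ] CochainFun L M k where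
  toFun F x p := Q (F x p)
  map_add' F G := by ext; simp
  map_smul' c F := by ext; simp [LinearMap.map_smul_of_tower]

/-- The coboundary `d_{N,M}` of the Nijenhuis operator `N` with coefficients in `(M, ρ, Q)`: the
Chevalley–Eilenberg formula for `ρ(N(p))` and `[·_λ ·]_N`, minus `Q ∘ δ`. -/
def dN (br : L →ₗ[ℂ] L →ₗ[ℂ] LPoly 1 L) (N : L →ₗ[ℂ[X]] L)
    (ρ : L →ₗ[ℂ] M →ₗ[ℂ] LPoly 1 M) (Q : M →ₗ[ℂ[X]] M) (k : ℕ) :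
    PreCochain L M k →ₗ[ℂ] CochainFun L M (k + 1) :=
  chevalleyEilenberg (fun Λ p => lam ρ Λ (N p)) (nijBracket br N) k -
    postComp Q (k + 1) ∘ₗ delta br ρ k

/-- The map `ξ`: the sum over all sets `S` of slots of
`(-1)^{|S|} Q^{|S|} f(…)`, with `pᵢ` in the slots of `S` and `N(pᵢ)` in the others. -/
def xi (N : L →ₗ[ℂ[X]] L) (Q : M →ₗ[ℂ[X]] M) (k : ℕ) :
    PreCochain L M k →ₗ[ℂ] CochainFun L M k where
  toFun f x p := ∑ S : Finset (Fin (k + 1)), (-1 : ℤ) ^ S.card •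
    (Q ^ S.card) (values k f x fun i => if i ∈ S then p i else N (p i))
  map_add' f g := by
    ext x p
    simp only [map_add, Pi.add_apply, smul_add, Finset.sum_add_distrib]
  map_smul' c f := by
    ext x p
    simp only [map_smul, Pi.smul_apply, RingHom.id_apply, LinearMap.map_smul_of_tower,
      Finset.smul_sum, smul_comm _ c]

variable (L M)

/-- The cochains of degree `k + 2` of a Nijenhuis Lie conformal algebra `L` with coefficients in
`M`: `C^{k+2}(L, M) ⊕ C^{k+1}(L, M)`. -/
def NLCochain (k : ℕ) : Type _ := cochains L M (k + 1) × cochains L M k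

instance NLCochain.addCommGroup (k : ℕ) : AddCommGroup (NLCochain L M k) :=
  inferInstanceAs (AddCommGroup (cochains L M (k + 1) × cochains L M k))

instance NLCochain.module (k : ℕ) : Module ℂ (NLCochain L M k) :=
  inferInstanceAs (Module ℂ (cochains L M (k + 1) × cochains L M k))

variable {L M}

/-- A cochain `(f, g)` regarded as a pair of functions. -/
def NLvalues (k : ℕ) :
    NLCochain L M k →ₗ[ℂ] CochainFun L M (k + 1) × CochainFun L M k :=
  (((values (k + 1)) ∘ₗ (cochains L M (k + 1)).subtype).prodMap
    ((values k) ∘ₗ (cochains L M k).subtype) :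
      cochains L M (k + 1) × cochains L M k →ₗ[ℂ] CochainFun L M (k + 1) × CochainFun L M k)

/-- The coboundary `d_{NL}^n(f, g) = (δ f, (-1)^n ξ(f) + d_{N,M}(g))` in degree `n = k + 2`. -/
def dNL (br : L →ₗ[ℂ] L →ₗ[ℂ] LPoly 1 L) (N : L →ₗ[ℂ[X]] L)
    (ρ : L →ₗ[ℂ] M →ₗ[ℂ] LPoly 1 M) (Q : M →ₗ[ℂ[X]] M) (k : ℕ) :
    NLCochain L M k →ₗ[ℂ] CochainFun L M (k + 2) × CochainFun L M (k + 1) :=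
  let ι := (cochains L M (k + 1)).subtype ∘ₗ LinearMap.fst ℂ _ (cochains L M k)
  let ι' := (cochains L M k).subtype ∘ₗ LinearMap.snd ℂ (cochains L M (k + 1)) _
  ((delta br ρ (k + 1) ∘ₗ ι).prod
    ((-1 : ℤ) ^ (k + 2) • (xi N Q (k + 1) ∘ₗ ι) + dN br N ρ Q k ∘ₗ ι') :
      cochains L M (k + 1) × cochains L M k →ₗ[ℂ]
        CochainFun L M (k + 2) × CochainFun L M (k + 1))

end Cochains

/-- The structure of a Nijenhuis Lie conformal algebra on the `ℂ[∂]`-module `L`. -/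
@[ext]
structure NijenhuisLCA (L : Type*) [AddCommGroup L] [Module ℂ L] [Module ℂ[X] L]
    [IsScalarTower ℂ ℂ[X] L] where
  /-- the `λ`-bracket `[p_λ q]` -/
  br : L →ₗ[ℂ] L →ₗ[ℂ] LPoly 1 L
  sesq : IsSesquilinear br
  skew : ∀ (x : ℂ) (p q : L), lam br (.C x) p q = -lam br (-.X - .C x) q p
  jacobi : ∀ (x y : ℂ) (p q r : L),
    lam br (.C x) p (lam br (.C y) q r) =
      lam br (.C (x + y)) (lam br (.C x) p q) r + lam br (.C y) q (lam br (.C x) p r)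
  /-- the Nijenhuis operator -/
  N : L →ₗ[ℂ[X]] L
  nij : ∀ (x : ℂ) (p q : L),
    lam br (.C x) (N p) (N q) =
      N (lam br (.C x) (N p) q + lam br (.C x) p (N q) - N (lam br (.C x) p q))

/-- The structure of a Nijenhuis representation of `A` on the `ℂ[∂]`-module `M`. -/
@[ext]
structure NijenhuisRep {L : Type*} [AddCommGroup L] [Module ℂ L] [Module ℂ[X] L]
    [IsScalarTower ℂ ℂ[X] L] (A : NijenhuisLCA L)
    (M : Type*) [AddCommGroup M] [Module ℂ M] [Module ℂ[X] M] [IsScalarTower ℂ ℂ[X] M] where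
  /-- the action `ρ(p)_λ m` -/
  ρ : L →ₗ[ℂ] M →ₗ[ℂ] LPoly 1 M
  sesq : IsSesquilinear ρ
  rep : ∀ (x y : ℂ) (p q : L) (m : M),
    lam ρ (.C (x + y)) (lam A.br (.C x) p q) m =
      lam ρ (.C x) p (lam ρ (.C y) q m) - lam ρ (.C y) q (lam ρ (.C x) p m)
  /-- the operator on the representation -/
  Q : M →ₗ[ℂ[X]] M
  nij : ∀ (x : ℂ) (p : L) (m : M),
    lam ρ (.C x) (A.N p) (Q m) =
      Q (lam ρ (.C x) (A.N p) m + lam ρ (.C x) p (Q m) - Q (lam ρ (.C x) p m))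

section Cohomology

variable {L : Type*} [AddCommGroup L] [Module ℂ L] [Module ℂ[X] L] [IsScalarTower ℂ ℂ[X] L]
  {M : Type*} [AddCommGroup M] [Module ℂ M] [Module ℂ[X] M] [IsScalarTower ℂ ℂ[X] M]
  (A : NijenhuisLCA L) (R : NijenhuisRep A M)

/-- The cocycles of degree `k + 2` of `A` with coefficients in `R`. -/
def NLcocycles (k : ℕ) : Submodule ℂ (NLCochain L M k) :=
  LinearMap.ker (dNL A.br A.N R.ρ R.Q k)

/-- The coboundaries of degree `k + 3` of `A` with coefficients in `R`. -/
def NLcoboundaries (k : ℕ) : Submodule ℂ (NLCochain L M (k + 1)) :=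
  (LinearMap.range (dNL A.br A.N R.ρ R.Q k)).comap (NLvalues (k + 1))

/-- The cohomology group `H^{k+3}_{NL}(A, R)`: cocycles modulo coboundaries. -/
def NLcohomology (k : ℕ) : Type _ :=
  NLcocycles A R (k + 1) ⧸ (NLcoboundaries A R k).submoduleOf (NLcocycles A R (k + 1))

instance NLcohomology.addCommGroup (k : ℕ) : AddCommGroup (NLcohomology A R k) :=
  inferInstanceAs (AddCommGroup
    (NLcocycles A R (k + 1) ⧸ (NLcoboundaries A R k).submoduleOf (NLcocycles A R (k + 1))))

instance NLcohomology.module (k : ℕ) : Module ℂ (NLcohomology A R k) :=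
  inferInstanceAs (Module ℂ
    (NLcocycles A R (k + 1) ⧸ (NLcoboundaries A R k).submoduleOf (NLcocycles A R (k + 1))))

/-- The cohomology class of a cocycle of degree `k + 3`. -/
def NLclass (k : ℕ) : NLcocycles A R (k + 1) →ₗ[ℂ] NLcohomology A R k :=
  ((NLcoboundaries A R k).submoduleOf (NLcocycles A R (k + 1))).mkQ

end Cohomology

section TwoTerm

variable (L₀ : Type*) [AddCommGroup L₀] [Module ℂ L₀] [Module ℂ[X] L₀] [IsScalarTower ℂ ℂ[X] L₀]
  (L₁ : Type*) [AddCommGroup L₁] [Module ℂ L₁] [Module ℂ[X] L₁] [IsScalarTower ℂ ℂ[X] L₁]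

/-- A 2-term `L_∞`-conformal algebra on the `ℂ[∂]`-modules `L₀` and `L₁`.  The bracket of two
elements of `L₁` lies in `L₂ = 0`, so only three components of the bracket occur. -/
structure TwoTermLInfinity where
  d : L₁ →ₗ[ℂ[X]] L₀
  br₀₀ : L₀ →ₗ[ℂ] L₀ →ₗ[ℂ] LPoly 1 L₀
  br₀₁ : L₀ →ₗ[ℂ] L₁ →ₗ[ℂ] LPoly 1 L₁
  br₁₀ : L₁ →ₗ[ℂ] L₀ →ₗ[ℂ] LPoly 1 L₁
  /-- conformally sesquilinear and skew-symmetric -/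
  l₃ : cochains L₀ L₁ 2
  sesq₀₀ : IsSesquilinear br₀₀
  sesq₀₁ : IsSesquilinear br₀₁
  sesq₁₀ : IsSesquilinear br₁₀
  skew₀₁ : ∀ (x : ℂ) (p : L₀) (m : L₁), lam br₀₁ (.C x) p m = -lam br₁₀ (-.X - .C x) m p
  skew₀₀ : ∀ (x : ℂ) (p q : L₀), lam br₀₀ (.C x) p q = -lam br₀₀ (-.X - .C x) q p
  d_br : ∀ (x : ℂ) (p : L₀) (m : L₁), d (lam br₀₁ (.C x) p m) = lam br₀₀ (.C x) p (d m)
  br_d : ∀ (x : ℂ) (m n : L₁), lam br₀₁ (.C x) (d m) n = lam br₁₀ (.C x) m (d n)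
  d_l₃ : ∀ (x y : ℂ) (p q r : L₀),
    d (values 2 l₃.1 ![x, y] ![p, q, r]) =
      lam br₀₀ (.C x) p (lam br₀₀ (.C y) q r) -
        lam br₀₀ (.C (x + y)) (lam br₀₀ (.C x) p q) r -
        lam br₀₀ (.C y) q (lam br₀₀ (.C x) p r)
  l₃_d : ∀ (x y : ℂ) (p q : L₀) (m : L₁),
    values 2 l₃.1 ![x, y] ![p, q, d m] =
      lam br₀₁ (.C x) p (lam br₀₁ (.C y) q m) -
        lam br₀₁ (.C (x + y)) (lam br₀₀ (.C x) p q) m -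
        lam br₀₁ (.C y) q (lam br₀₁ (.C x) p m)
  coherence : ∀ (x y z : ℂ) (p q r w : L₀),
    lam br₀₁ (.C x) p (values 2 l₃.1 ![y, z] ![q, r, w]) -
        lam br₀₁ (.C y) q (values 2 l₃.1 ![x, z] ![p, r, w]) +
        lam br₀₁ (.C z) r (values 2 l₃.1 ![x, y] ![p, q, w]) -
        lam br₀₁ (-.X - .C x - .C y - .C z) w (values 2 l₃.1 ![x, y] ![p, q, r]) =
      values 2 l₃.1 ![x + y, z] ![lam br₀₀ (.C x) p q, r, w] +
        values 2 l₃.1 ![y, x + z] ![q, lam br₀₀ (.C x) p r, w] +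
        values 2 l₃.1 ![y, z] ![q, r, lam br₀₀ (.C x) p w] -
        values 2 l₃.1 ![x, y + z] ![p, lam br₀₀ (.C y) q r, w] -
        values 2 l₃.1 ![x, z] ![p, r, lam br₀₀ (.C y) q w] +
        values 2 l₃.1 ![x, y] ![p, q, lam br₀₀ (.C z) r w]

/-- A 2-term Nijenhuis `L_∞`-conformal algebra: a 2-term `L_∞`-conformal algebra with a homotopy
Nijenhuis operator `(N₀, N₁, N₂)`. -/
structure TwoTermNijenhuisLInfinity extends TwoTermLInfinity L₀ L₁ where
  N₀ : L₀ →ₗ[ℂ[X]] L₀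
  N₁ : L₁ →ₗ[ℂ[X]] L₁
  /-- conformally sesquilinear and skew-symmetric -/
  N₂ : cochains L₀ L₁ 1
  d_N₁ : ∀ m : L₁, d (N₁ m) = N₀ (d m)
  d_N₂ : ∀ (x : ℂ) (p q : L₀),
    d (values 1 N₂.1 ![x] ![p, q]) =
      N₀ (nijBracket br₀₀ N₀ x p q) - lam br₀₀ (.C x) (N₀ p) (N₀ q)
  N₂_d : ∀ (x : ℂ) (p : L₀) (m : L₁),
    values 1 N₂.1 ![x] ![p, d m] =
      N₁ (lam br₀₁ (.C x) (N₀ p) m + lam br₀₁ (.C x) p (N₁ m) - N₁ (lam br₀₁ (.C x) p m)) -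
        lam br₀₁ (.C x) (N₀ p) (N₁ m)
  N_coherence : ∀ (x y : ℂ) (p q r : L₀),
    lam br₀₁ (.C x) (N₀ p) (values 1 N₂.1 ![y] ![q, r]) -
        lam br₀₁ (.C y) (N₀ q) (values 1 N₂.1 ![x] ![p, r]) -
        lam br₁₀ (.C (x + y)) (values 1 N₂.1 ![x] ![p, q]) (N₀ r) -
        values 1 N₂.1 ![x + y] ![nijBracket br₀₀ N₀ x p q, r] +
        values 1 N₂.1 ![x] ![p, nijBracket br₀₀ N₀ y q r] -
        values 1 N₂.1 ![y] ![q, nijBracket br₀₀ N₀ x p r] -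
        N₁ (lam br₀₁ (.C x) p (values 1 N₂.1 ![y] ![q, r]) -
          lam br₀₁ (.C y) q (values 1 N₂.1 ![x] ![p, r]) -
          lam br₁₀ (.C (x + y)) (values 1 N₂.1 ![x] ![p, q]) r -
          values 1 N₂.1 ![x + y] ![lam br₀₀ (.C x) p q, r] +
          values 1 N₂.1 ![x] ![p, lam br₀₀ (.C y) q r] -
          values 1 N₂.1 ![y] ![q, lam br₀₀ (.C x) p r]) =
      values 2 l₃.1 ![x, y] ![N₀ p, N₀ q, N₀ r] -
        N₁ (values 2 l₃.1 ![x, y] ![N₀ p, N₀ q, r] +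
          values 2 l₃.1 ![x, y] ![N₀ p, q, N₀ r] +
          values 2 l₃.1 ![x, y] ![p, N₀ q, N₀ r]) +
        N₁ (N₁ (values 2 l₃.1 ![x, y] ![N₀ p, q, r] +
          values 2 l₃.1 ![x, y] ![p, N₀ q, r] +
          values 2 l₃.1 ![x, y] ![p, q, N₀ r])) -
        N₁ (N₁ (N₁ (values 2 l₃.1 ![x, y] ![p, q, r])))

/-- The skeletal 2-term Nijenhuis `L_∞`-conformal algebras on `L₀` and `L₁`. -/
abbrev SkeletalNijenhuis : Type _ := {S : TwoTermNijenhuisLInfinity L₀ L₁ // S.d = 0}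

variable {L₀ L₁}

/-- Equivalence of skeletal 2-term Nijenhuis `L_∞`-conformal algebras on the same complex: the
brackets, `N₀` and `N₁` agree, and `(l₃', N₂') = (l₃, N₂) + d_{NL}²(f, θ)` for a 2-cochain `(f, θ)`
of `(L₀, N₀)` with coefficients in `(L₁, N₁)`. -/
def SkeletalEquiv (S S' : SkeletalNijenhuis L₀ L₁) : Prop :=
  S.1.br₀₀ = S'.1.br₀₀ ∧ S.1.br₀₁ = S'.1.br₀₁ ∧ S.1.br₁₀ = S'.1.br₁₀ ∧
  S.1.N₀ = S'.1.N₀ ∧ S.1.N₁ = S'.1.N₁ ∧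
  ∃ c : NLCochain L₀ L₁ 0,
    NLvalues 1 (S'.1.l₃, S'.1.N₂) =
      NLvalues 1 (S.1.l₃, S.1.N₂) + dNL S.1.br₀₀ S.1.N₀ S.1.br₀₁ S.1.N₁ 0 c

variable (L₀ L₁) in
/-- The setoid of equivalence of skeletal 2-term Nijenhuis `L_∞`-conformal algebras. -/
def skeletalSetoid : Setoid (SkeletalNijenhuis L₀ L₁) where
  r := SkeletalEquiv
  iseqv :=
    { refl := fun S => ⟨rfl, rfl, rfl, rfl, rfl, 0, by simp⟩
      symm := by
        rintro S S' ⟨h1, h2, h3, h4, h5, c, hc⟩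
        refine ⟨h1.symm, h2.symm, h3.symm, h4.symm, h5.symm, -c, ?_⟩
        rw [hc, ← h1, ← h2, ← h4, ← h5, map_neg, add_neg_cancel_right]
      trans := by
        rintro S S' S'' ⟨h1, h2, h3, h4, h5, c, hc⟩ ⟨k1, k2, k3, k4, k5, e, he⟩
        refine ⟨h1.trans k1, h2.trans k2, h3.trans k3, h4.trans k4, h5.trans k5, c + e, ?_⟩
        rw [he, hc, ← h1, ← h2, ← h4, ← h5, map_add, add_assoc] }

variable (L₀ L₁) in
/-- Triples `(A, R, c)`: a Nijenhuis Lie conformal algebra structure `A` on `L₀`, a Nijenhuis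
representation `R` of `A` on `L₁`, and a class `c ∈ H³_{NL}(A, R)`. -/
abbrev NijenhuisTriple : Type _ :=
  Σ A : NijenhuisLCA L₀, Σ R : NijenhuisRep A L₁, NLcohomology A R 0

end TwoTerm

end

/-!
A skeletal 2-term Nijenhuis `L_∞`-conformal algebra is the same thing as a Nijenhuis Lie conformal
algebra `A`, a Nijenhuis representation `R` of `A` and a 3-cocycle of `A` with coefficients in `R`.
Indeed, once `d = 0`, the laws involving `d l₃`, `l₃(p, q, d m)`, `d N₂` and `N₂(p, d m)` become the
Jacobi identity, the representation property and the two Nijenhuis identities, and the two coherence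
laws say exactly that `(l₃, N₂)` is a cocycle (`mem_NLcocycles_three_iff`).  Equivalence of skeletal
algebras is then, by definition, equality of the structures and of the cohomology classes
(`tripleOfCocycle_eq_iff`).

Two points need an argument.

* In the Chevalley–Eilenberg formula the bracket always sits in the first slot of the cochain, and
  its subscripts may involve `-∂ - λ₁ - ⋯`, whereas in the coherence laws the bracket stays in
  place and the subscripts of the cochains are complex numbers.  Conformal skew-symmetry converts
  one into the other
  (`chevalleyEilenberg_two`, `chevalleyEilenberg_three`).
* The bracket `L₁ ⊗ L₀ → L₁[λ]` is redundant: it is the opposite `-[p_{-∂-λ} m]` of the action.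
  Skew-symmetry gives this only with the roles of the two brackets exchanged and only at complex
  `λ`; since an `M`-valued polynomial is determined by its values at complex points
  (`LPoly.ext_of_ev`) and `λ ↦ -∂ - λ` is an involution, the bracket is recovered from the action
  (`eq_opProduct`).  Conversely the opposite of the action is a sesquilinear `λ`-product
  (`IsSesquilinear.opProduct`), which provides the bracket of the algebra built from a cocycle.
-/

noncomputable section

/-! ### Polynomials with coefficients in a `ℂ[∂]`-module -/

section Polynomials

variable {M : Type*} [AddCommGroup M] [Module ℂ M]

/-- The monomial `λˢ m`. -/
def LPoly.monomial {k : ℕ} (s : Fin k →₀ ℕ) : M →ₗ[ℂ] LPoly k M :=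
  (Finsupp.lsingle s : M →ₗ[ℂ] ((Fin k →₀ ℕ) →₀ M))

lemma LPoly.hom_ext {k : ℕ} {P : Type*} [AddCommGroup P] [Module ℂ P]
    {f g : LPoly k M →ₗ[ℂ] P} (h : ∀ s m, f (LPoly.monomial s m) = g (LPoly.monomial s m)) :
    f = g :=
  Finsupp.lhom_ext (M := M) h

/-- Multiplication by `λ` on `M[λ]`. -/
def LPoly.mulVar : LPoly 1 M →ₗ[ℂ] LPoly 1 M :=
  (Finsupp.lmapDomain M ℂ (· + Finsupp.single 0 1) :
    ((Fin 1 →₀ ℕ) →₀ M) →ₗ[ℂ] ((Fin 1 →₀ ℕ) →₀ M))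

lemma LPoly.mulVar_monomial (s : Fin 1 →₀ ℕ) (m : M) :
    LPoly.mulVar (LPoly.monomial s m) = LPoly.monomial (s + Finsupp.single 0 1) m :=
  Finsupp.mapDomain_single

variable [Module ℂ[X] M] [IsScalarTower ℂ ℂ[X] M]

/-- The action of `∂` on the coefficients of an element of `M[λ]`. -/
def LPoly.deriv : LPoly 1 M →ₗ[ℂ] LPoly 1 M :=
  (Finsupp.mapRange.linearMap (Algebra.lsmul ℂ ℂ M (.X : ℂ[X])) :
    ((Fin 1 →₀ ℕ) →₀ M) →ₗ[ℂ] ((Fin 1 →₀ ℕ) →₀ M))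

lemma LPoly.deriv_monomial (s : Fin 1 →₀ ℕ) (m : M) :
    LPoly.deriv (LPoly.monomial s m) = LPoly.monomial s ((.X : ℂ[X]) • m) :=
  Finsupp.mapRange_single (hf := smul_zero _)

/-- The substitution `λ ↦ -∂ - λ` as a map `M[λ] → M[λ]`. -/
def LPoly.flip : LPoly 1 M →ₗ[ℂ] LPoly 1 M :=
  (Finsupp.lsum ℂ fun s =>
      ((-deriv - mulVar : Module.End ℂ (LPoly 1 M)) ^ s 0) ∘ₗ monomial 0 :
    ((Fin 1 →₀ ℕ) →₀ M) →ₗ[ℂ] LPoly 1 M)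

lemma LPoly.flip_monomial (s : Fin 1 →₀ ℕ) (m : M) :
    LPoly.flip (LPoly.monomial s m) =
      ((-deriv - mulVar : Module.End ℂ (LPoly 1 M)) ^ s 0) (LPoly.monomial 0 m) :=
  Finsupp.sum_single_index (map_zero _)

lemma ev_monomial {k : ℕ} (Λ : Fin k → ℂ[X]) (s : Fin k →₀ ℕ) (m : M) :
    ev Λ (LPoly.monomial s m) = (∏ i, Λ i ^ s i) • m :=
  Finsupp.sum_single_index (smul_zero _)

lemma ev_mulVar (Λ : ℂ[X]) (f : LPoly 1 M) :
    ev (fun _ => Λ) (LPoly.mulVar f) = Λ • ev (fun _ => Λ) f := by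
  suffices h : ev (fun _ => Λ) ∘ₗ LPoly.mulVar =
      Algebra.lsmul ℂ ℂ M Λ ∘ₗ ev fun _ => Λ from DFunLike.congr_fun h f
  refine LPoly.hom_ext fun s m => ?_
  simp [LPoly.mulVar_monomial, ev_monomial, pow_succ', mul_smul]

lemma ev_deriv (Λ : ℂ[X]) (f : LPoly 1 M) :
    ev (fun _ => Λ) (LPoly.deriv f) = (.X : ℂ[X]) • ev (fun _ => Λ) f := by
  suffices h : ev (fun _ => Λ) ∘ₗ LPoly.deriv =
      Algebra.lsmul ℂ ℂ M (.X : ℂ[X]) ∘ₗ ev fun _ => Λ from DFunLike.congr_fun h f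
  refine LPoly.hom_ext fun s m => ?_
  simp [LPoly.deriv_monomial, ev_monomial, smul_smul, mul_comm]

lemma ev_flip (Λ : ℂ[X]) (f : LPoly 1 M) :
    ev (fun _ => Λ) (LPoly.flip f) = ev (fun _ => -.X - Λ) f := by
  suffices h : ev (fun _ => Λ) ∘ₗ LPoly.flip = ev (M := M) fun _ => -.X - Λ from
    DFunLike.congr_fun h f
  have hpow (n : ℕ) (g : LPoly 1 M) :
      ev (fun _ => Λ) (((-LPoly.deriv - LPoly.mulVar : Module.End ℂ (LPoly 1 M)) ^ n) g) =
        (-.X - Λ) ^ n • ev (fun _ => Λ) g := by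
    induction n with
    | zero => simp
    | succ n ih =>
      rw [pow_succ', Module.End.mul_apply, pow_succ', mul_smul, ← ih, LinearMap.sub_apply,
        LinearMap.neg_apply, map_sub, map_neg, ev_deriv, ev_mulVar, sub_smul, neg_smul]
  refine LPoly.hom_ext fun s m => ?_
  rw [LinearMap.comp_apply, LPoly.flip_monomial, hpow, ev_monomial, ev_monomial]
  simp

/-- An `M`-valued polynomial is determined by its values at complex points: linear functionals on
`M` reduce this to the case of scalar polynomials over the infinite field `ℂ`. -/
lemma LPoly.ext_of_ev {k : ℕ} {f g : LPoly k M}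
    (h : ∀ x : Fin k → ℂ, ev (fun i => .C (x i)) f = ev (fun i => .C (x i)) g) : f = g := by
  rw [← sub_eq_zero]
  replace h (x : Fin k → ℂ) : ev (fun i => .C (x i)) (f - g) = 0 := by
    rw [map_sub, h, sub_self]
  generalize f - g = u at h
  let v : (Fin k →₀ ℕ) →₀ M := u
  suffices hv : v = 0 from hv
  ext s
  rw [Finsupp.zero_apply, ← Module.forall_dual_apply_eq_zero_iff ℂ]
  intro φ
  let P : MvPolynomial (Fin k) ℂ := v.sum fun t m => MvPolynomial.monomial t (φ m)
  have hP : P = 0 := by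
    refine MvPolynomial.funext fun x => ?_
    have hx : φ (v.sum fun t m => (∏ i, (Polynomial.C (x i)) ^ t i) • m) = 0 := by
      have := congrArg φ (h x)
      rwa [map_zero, show ev (fun i => .C (x i)) u =
        v.sum fun t m => (∏ i, (Polynomial.C (x i)) ^ t i) • m from rfl] at this
    simp only [P, Finsupp.sum, map_sum] at hx ⊢
    rw [map_zero, ← hx]
    refine Finset.sum_congr rfl fun t _ => ?_
    have hC : ∏ i, (Polynomial.C (x i)) ^ t i = algebraMap ℂ ℂ[X] (∏ i, x i ^ t i) := by
      simp
    rw [hC, algebraMap_smul, map_smul, MvPolynomial.eval_monomial, smul_eq_mul, mul_comm,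
      Finsupp.prod_fintype _ _ fun _ => pow_zero _]
  have hs : MvPolynomial.coeff s P = φ (v s) := by
    classical
    simp only [P, Finsupp.sum, MvPolynomial.coeff_sum, MvPolynomial.coeff_monomial,
      Finset.sum_ite_eq']
    split_ifs with hmem
    · rfl
    · rw [Finsupp.notMem_support_iff.mp hmem, map_zero]
  rw [← hs, hP, MvPolynomial.coeff_zero]

lemma LPoly.ext_of_ev_one {f g : LPoly 1 M}
    (h : ∀ x : ℂ, ev (fun _ => .C x) f = ev (fun _ => .C x) g) : f = g :=
  LPoly.ext_of_ev fun x => by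
    have hx : (fun i => Polynomial.C (x i)) = fun _ => .C (x 0) := by
      ext1 i; rw [Subsingleton.elim i 0]
    rw [hx, h]

/-! ### Sesquilinear `λ`-products and their opposites -/

section Products

variable {P Q : Type*} [AddCommGroup P] [Module ℂ P] [AddCommGroup Q] [Module ℂ Q]

/-- Sesquilinearity, required at complex `λ`, holds at every polynomial in `∂`. -/
lemma IsSesquilinear.lam_smul_left [Module ℂ[X] P] [Module ℂ[X] Q]
    {b : P →ₗ[ℂ] Q →ₗ[ℂ] LPoly 1 M} (hb : IsSesquilinear b) (Λ : ℂ[X]) (p : P) (q : Q) :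
    lam b Λ ((.X : ℂ[X]) • p) q = -(Λ • lam b Λ p q) := by
  have h : b ((.X : ℂ[X]) • p) q = -LPoly.mulVar (b p q) := LPoly.ext_of_ev_one fun x => by
    rw [map_neg, ev_mulVar, ← Polynomial.algebraMap_eq, algebraMap_smul]
    exact (hb x p q).1
  change ev _ (b _ _) = -(Λ • ev _ (b _ _))
  rw [h, map_neg, ev_mulVar]

/-- Sesquilinearity, required at complex `λ`, holds at every polynomial in `∂`. -/
lemma IsSesquilinear.lam_smul_right [Module ℂ[X] P] [Module ℂ[X] Q]
    {b : P →ₗ[ℂ] Q →ₗ[ℂ] LPoly 1 M} (hb : IsSesquilinear b) (Λ : ℂ[X]) (p : P) (q : Q) :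
    lam b Λ p ((.X : ℂ[X]) • q) = (.X + Λ : ℂ[X]) • lam b Λ p q := by
  have h : b p ((.X : ℂ[X]) • q) = LPoly.deriv (b p q) + LPoly.mulVar (b p q) :=
    LPoly.ext_of_ev_one fun x => by
      rw [map_add, ev_deriv, ev_mulVar, ← add_smul]
      exact (hb x p q).2
  change ev _ (b _ _) = (.X + Λ : ℂ[X]) • ev _ (b _ _)
  rw [h, map_add, ev_deriv, ev_mulVar, add_smul]

/-- The opposite `λ`-product `(q, p) ↦ -(p_{-∂-λ} q)`. -/
def opProduct (b : P →ₗ[ℂ] Q →ₗ[ℂ] LPoly 1 M) : Q →ₗ[ℂ] P →ₗ[ℂ] LPoly 1 M :=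
  -(b.compr₂ LPoly.flip).flip

lemma lam_opProduct (b : P →ₗ[ℂ] Q →ₗ[ℂ] LPoly 1 M) (Λ : ℂ[X]) (p : P) (q : Q) :
    lam (opProduct b) Λ q p = -lam b (-.X - Λ) p q := by
  change ev _ (-LPoly.flip (b p q)) = -ev _ (b p q)
  rw [map_neg, ev_flip]

lemma IsSesquilinear.opProduct [Module ℂ[X] P] [Module ℂ[X] Q]
    {b : P →ₗ[ℂ] Q →ₗ[ℂ] LPoly 1 M} (hb : IsSesquilinear b) :
    IsSesquilinear (opProduct b) := by
  intro x q p
  simp only [lam_opProduct, hb.lam_smul_left, hb.lam_smul_right]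
  constructor
  · rw [← Polynomial.algebraMap_eq, ← algebraMap_smul ℂ[X] x]
    module
  · module

/-- Skew-symmetry `p_λ q = -(q_{-∂-λ} p)` at complex `λ` already determines the product of `q` and
`p`, because `λ ↦ -∂ - λ` is an involution. -/
lemma eq_opProduct {b : P →ₗ[ℂ] Q →ₗ[ℂ] LPoly 1 M} {c : Q →ₗ[ℂ] P →ₗ[ℂ] LPoly 1 M}
    (h : ∀ (x : ℂ) (p : P) (q : Q), lam b (.C x) p q = -lam c (-.X - .C x) q p) :
    c = _root_.opProduct b := by
  ext1 q
  ext1 p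
  have h' : b p q = -LPoly.flip (c q p) := LPoly.ext_of_ev_one fun x => by
    rw [map_neg, ev_flip]
    exact h x p q
  refine LPoly.ext_of_ev_one fun x => ?_
  change _ = lam (_root_.opProduct b) (.C x) q p
  rw [lam_opProduct]
  change _ = -ev _ (b p q)
  rw [h', map_neg, ev_flip, neg_neg, sub_sub_cancel]

end Products

end Polynomials

/-! ### The Chevalley–Eilenberg formula in degrees two and three -/

section LowDegree

variable {L M : Type*} [AddCommGroup L] [Module ℂ L]
  [AddCommGroup M] [Module ℂ M] [Module ℂ[X] M] [IsScalarTower ℂ ℂ[X] M]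

lemma full_one (x : ℂ) : full ![x] = ![.C x, -.X - .C x] := by
  ext1 i; fin_cases i <;> simp [full, Fin.snoc]

lemma full_two (x y : ℂ) : full ![x, y] = ![.C x, .C y, -.X - .C x - .C y] := by
  ext1 i; fin_cases i <;> simp [full, Fin.snoc, sub_sub]

lemma full_three (x y z : ℂ) :
    full ![x, y, z] = ![.C x, .C y, .C z, -.X - .C x - .C y - .C z] := by
  ext1 i; fin_cases i <;> simp [full, Fin.snoc, Fin.sum_univ_three, sub_sub, add_assoc]; rfl

lemma values_one_eq (f : PreCochain L M 1) (x : ℂ) (p q : L) :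
    values 1 f ![x] ![p, q] = ev ![.C x] (f ![p, q]) := by
  change ev _ _ = _
  congr 2; ext1 i; fin_cases i; rfl

lemma values_two_eq (f : PreCochain L M 2) (x y : ℂ) (p q r : L) :
    values 2 f ![x, y] ![p, q, r] = ev ![.C x, .C y] (f ![p, q, r]) := by
  change ev _ _ = _
  congr 2; ext1 i; fin_cases i <;> rfl

variable [Module ℂ[X] L]

/-- Conformal skew-symmetry, with the permuted arguments named independently. -/
lemma ev_cochain_perm {k : ℕ} (f : cochains L M k) (x : Fin k → ℂ) (p : Fin (k + 1) → L)
    (σ : Equiv.Perm (Fin (k + 1))) {Λ : Fin k → ℂ[X]} {P : Fin (k + 1) → L}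
    (hΛ : Λ = Fin.init (full x ∘ σ)) (hP : P = p ∘ σ) :
    ev Λ (f.1 P) = (Equiv.Perm.sign σ : ℤ) • values k f.1 x p := by
  subst hΛ hP
  change _ = _ • ev _ (f.1 p)
  rw [f.2.2 x p σ, smul_smul, ← Units.val_mul, Int.units_mul_self, Units.val_one, one_smul]

/-- A `2`-cochain whose `λ` involves `∂`: exchanging the arguments makes the `λ` complex. -/
lemma values_one_cycle (f : cochains L M 1) {Λ : ℂ[X]} (y : ℂ) (hΛ : Λ = -.X - .C y) (p q : L) :
    ev ![Λ] (f.1 ![p, q]) = -values 1 f.1 ![y] ![q, p] := by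
  rw [ev_cochain_perm f ![y] ![q, p] (Equiv.swap 0 1)]
  · simp
  · ext1 i; fin_cases i; simp [full_one, Fin.init, hΛ]
  · ext1 i; fin_cases i <;> rfl

lemma values_two_swap (f : cochains L M 2) (x y : ℂ) (p q r : L) :
    values 2 f.1 ![x, y] ![p, q, r] = -values 2 f.1 ![y, x] ![q, p, r] := by
  rw [values_two_eq, ev_cochain_perm f ![y, x] ![q, p, r] (Equiv.swap 0 1)]
  · simp
  · ext1 i; fin_cases i <;> simp [full_two, Fin.init]
  · ext1 i; fin_cases i <;> rfl

/-- A `3`-cochain whose first `λ` involves `∂`: cyclically permuting the arguments makes both `λ`'s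
complex. -/
lemma values_two_cycle (f : cochains L M 2) {Λ : ℂ[X]} (y z : ℂ) (hΛ : Λ = -.X - .C y - .C z)
    (p q r : L) :
    ev ![Λ, .C y] (f.1 ![p, q, r]) = values 2 f.1 ![y, z] ![q, r, p] := by
  rw [ev_cochain_perm f ![y, z] ![q, r, p] (Equiv.swap 0 1 * Equiv.swap 0 2)]
  · simp
  · have h : (Equiv.swap 0 1 : Equiv.Perm (Fin 3)) 2 = 2 := by decide
    ext1 i; fin_cases i
    · simp [full_two, Fin.init, hΛ, h]
    · simp [full_two, Fin.init]; rfl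
  · ext1 i; fin_cases i <;> rfl

/-! Restrictions of explicit tuples, in the forms in which they occur in `chevalleyEilenberg`. -/

lemma init_two {α : Type*} (a b : α) : Fin.init (α := fun _ => α) ![a, b] = ![a] := by
  ext1 i; fin_cases i; rfl

lemma init_three {α : Type*} (a b c : α) :
    Fin.init (α := fun _ => α) ![a, b, c] = ![a, b] := by
  ext1 i; fin_cases i <;> rfl

lemma vecCons_comp_succ {α : Type*} {n : ℕ} (a : α) (v : Fin n → α) :
    Matrix.vecCons a v ∘ Fin.succ = v := rfl

lemma vecCons_comp_succAbove_one {α : Type*} {n : ℕ} (a b : α) (v : Fin n → α) :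
    Matrix.vecCons a (Matrix.vecCons b v) ∘ Fin.succAbove 1 = Matrix.vecCons a v := by
  ext1 i; cases i using Fin.cases <;> rfl

lemma vecCons_comp_succAbove_two {α : Type*} {n : ℕ} (a b c : α) (v : Fin n → α) :
    Matrix.vecCons a (Matrix.vecCons b (Matrix.vecCons c v)) ∘ Fin.succAbove 2 =
      Matrix.vecCons a (Matrix.vecCons b v) := by
  ext1 i
  cases i using Fin.cases with
  | zero => rfl
  | succ i => cases i using Fin.cases with
    | zero => rfl
    | succ i => rfl

lemma four_comp_succAbove_three {α : Type*} (a b c d : α) :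
    ![a, b, c, d] ∘ Fin.succAbove 3 = ![a, b, c] := by
  ext1 i; fin_cases i <;> rfl

lemma cons_eq_vecCons {α : Type*} {n : ℕ} (a : α) (v : Fin n → α) :
    (Fin.cons a v : Fin (n + 1) → α) = Matrix.vecCons a v := rfl

/-- The coboundary of a `2`-cochain in terms of its values at complex `λ`'s, with each bracket in
the place of its second argument. -/
lemma chevalleyEilenberg_two (a : ℂ[X] → L → M →ₗ[ℂ] M) (b : ℂ → L → L → L)
    (f : cochains L M 1) (x y : ℂ) (p q r : L) :
    chevalleyEilenberg a b 1 f.1 ![x, y] ![p, q, r] =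
      a (.C x) p (values 1 f.1 ![y] ![q, r]) - a (.C y) q (values 1 f.1 ![x] ![p, r]) +
        a (-.X - .C x - .C y) r (values 1 f.1 ![x] ![p, q]) -
        values 1 f.1 ![x + y] ![b x p q, r] + values 1 f.1 ![x] ![p, b y q r] -
        values 1 f.1 ![y] ![q, b x p r] := by
  simp [chevalleyEilenberg, full_two, Fin.sum_univ_succ, values_one_eq]
  simp only [← Function.comp_assoc, vecCons_comp_succ,
    vecCons_comp_succAbove_one, vecCons_comp_succAbove_two,
    cons_eq_vecCons, init_two]
  rw [values_one_cycle f y (by ring) (b x p r) q, values_one_cycle f x (by ring) (b y q r) p]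
  simp only [values_one_eq]
  abel

/-- The coboundary of a `3`-cochain in terms of its values at complex `λ`'s, with each bracket in
the place of its second argument. -/
lemma chevalleyEilenberg_three (a : ℂ[X] → L → M →ₗ[ℂ] M) (b : ℂ → L → L → L)
    (f : cochains L M 2) (x y z : ℂ) (p q r w : L) :
    chevalleyEilenberg a b 2 f.1 ![x, y, z] ![p, q, r, w] =
      a (.C x) p (values 2 f.1 ![y, z] ![q, r, w]) -
        a (.C y) q (values 2 f.1 ![x, z] ![p, r, w]) +
        a (.C z) r (values 2 f.1 ![x, y] ![p, q, w]) -
        a (-.X - .C x - .C y - .C z) w (values 2 f.1 ![x, y] ![p, q, r]) -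
      (values 2 f.1 ![x + y, z] ![b x p q, r, w] +
        values 2 f.1 ![y, x + z] ![q, b x p r, w] +
        values 2 f.1 ![y, z] ![q, r, b x p w] -
        values 2 f.1 ![x, y + z] ![p, b y q r, w] -
        values 2 f.1 ![x, z] ![p, r, b y q w] +
        values 2 f.1 ![x, y] ![p, q, b z r w]) := by
  simp [chevalleyEilenberg, full_three, Fin.sum_univ_succ, values_two_eq]
  simp only [← Function.comp_assoc, vecCons_comp_succ,
    vecCons_comp_succAbove_one, vecCons_comp_succAbove_two, four_comp_succAbove_three,
    cons_eq_vecCons, init_three]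
  rw [values_two_cycle f y z (by ring) (b x p w) q r,
    values_two_cycle f x z (by ring) (b y q w) p r,
    values_two_cycle f x y (by ring) (b z r w) p q]
  have h₁ := values_two_swap f y (x + z) q (b x p r) w
  have h₂ := values_two_swap f x (y + z) p (b y q r) w
  simp only [values_two_eq, map_add] at h₁ h₂ ⊢
  rw [h₁, h₂]
  abel

end LowDegree

/-! ### Cocycles of degree three and their classes -/

section Cocycles

variable {L : Type*} [AddCommGroup L] [Module ℂ L] [Module ℂ[X] L]
  {M : Type*} [AddCommGroup M] [Module ℂ M] [Module ℂ[X] M] [IsScalarTower ℂ ℂ[X] M]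

/-- The sum over the sets of slots in `ξ`, grouped by cardinality. -/
lemma xi_three (N : L →ₗ[ℂ[X]] L) (Q : M →ₗ[ℂ[X]] M) (f : PreCochain L M 2)
    (x : Fin 2 → ℂ) (p q r : L) :
    xi N Q 2 f x ![p, q, r] =
      values 2 f x ![N p, N q, N r] -
        Q (values 2 f x ![N p, N q, r] + values 2 f x ![N p, q, N r] +
          values 2 f x ![p, N q, N r]) +
        Q (Q (values 2 f x ![N p, q, r] + values 2 f x ![p, N q, r] +
          values 2 f x ![p, q, N r])) -
        Q (Q (Q (values 2 f x ![p, q, r]))) := by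
  have huniv : (Finset.univ : Finset (Finset (Fin 3))) =
      {∅, {0}, {1}, {2}, {0, 1}, {0, 2}, {1, 2}, {0, 1, 2}} := by decide
  have hS (S : Finset (Fin 3)) : (fun i => if i ∈ S then ![p, q, r] i else N (![p, q, r] i)) =
      ![if 0 ∈ S then p else N p, if 1 ∈ S then q else N q, if 2 ∈ S then r else N r] := by
    ext1 i; fin_cases i <;> rfl
  have hxi : xi N Q 2 f x ![p, q, r] = ∑ S : Finset (Fin 3), (-1 : ℤ) ^ S.card •
      (Q ^ S.card) (values 2 f x fun i => if i ∈ S then ![p, q, r] i else N (![p, q, r] i)) := rfl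
  rw [hxi]
  simp only [hS]
  rw [huniv, Finset.sum_insert (by decide), Finset.sum_insert (by decide),
    Finset.sum_insert (by decide), Finset.sum_insert (by decide), Finset.sum_insert (by decide),
    Finset.sum_insert (by decide), Finset.sum_insert (by decide), Finset.sum_singleton]
  simp [pow_succ]
  abel

variable [IsScalarTower ℂ ℂ[X] L] (A : NijenhuisLCA L) (R : NijenhuisRep A M)

/-- Membership in `Z³` spelled out.  The two conditions are the coherence laws of `l₃` and of `N₂`
in a 2-term Nijenhuis `L_∞`-conformal algebra whose bracket `L₁ ⊗ L₀ → L₁[λ]` is the opposite of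
the action. -/
lemma mem_NLcocycles_three_iff (f : cochains L M 2) (g : cochains L M 1) :
    (f, g) ∈ NLcocycles A R 1 ↔
      (∀ (x y z : ℂ) (p q r w : L),
        lam R.ρ (.C x) p (values 2 f.1 ![y, z] ![q, r, w]) -
            lam R.ρ (.C y) q (values 2 f.1 ![x, z] ![p, r, w]) +
            lam R.ρ (.C z) r (values 2 f.1 ![x, y] ![p, q, w]) -
            lam R.ρ (-.X - .C x - .C y - .C z) w (values 2 f.1 ![x, y] ![p, q, r]) =
          values 2 f.1 ![x + y, z] ![lam A.br (.C x) p q, r, w] +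
            values 2 f.1 ![y, x + z] ![q, lam A.br (.C x) p r, w] +
            values 2 f.1 ![y, z] ![q, r, lam A.br (.C x) p w] -
            values 2 f.1 ![x, y + z] ![p, lam A.br (.C y) q r, w] -
            values 2 f.1 ![x, z] ![p, r, lam A.br (.C y) q w] +
            values 2 f.1 ![x, y] ![p, q, lam A.br (.C z) r w]) ∧
      (∀ (x y : ℂ) (p q r : L),
        lam R.ρ (.C x) (A.N p) (values 1 g.1 ![y] ![q, r]) -
            lam R.ρ (.C y) (A.N q) (values 1 g.1 ![x] ![p, r]) -
            lam (opProduct R.ρ) (.C (x + y)) (values 1 g.1 ![x] ![p, q]) (A.N r) -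
            values 1 g.1 ![x + y] ![nijBracket A.br A.N x p q, r] +
            values 1 g.1 ![x] ![p, nijBracket A.br A.N y q r] -
            values 1 g.1 ![y] ![q, nijBracket A.br A.N x p r] -
            R.Q (lam R.ρ (.C x) p (values 1 g.1 ![y] ![q, r]) -
              lam R.ρ (.C y) q (values 1 g.1 ![x] ![p, r]) -
              lam (opProduct R.ρ) (.C (x + y)) (values 1 g.1 ![x] ![p, q]) r -
              values 1 g.1 ![x + y] ![lam A.br (.C x) p q, r] +
              values 1 g.1 ![x] ![p, lam A.br (.C y) q r] -
              values 1 g.1 ![y] ![q, lam A.br (.C x) p r]) =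
          values 2 f.1 ![x, y] ![A.N p, A.N q, A.N r] -
            R.Q (values 2 f.1 ![x, y] ![A.N p, A.N q, r] +
              values 2 f.1 ![x, y] ![A.N p, q, A.N r] +
              values 2 f.1 ![x, y] ![p, A.N q, A.N r]) +
            R.Q (R.Q (values 2 f.1 ![x, y] ![A.N p, q, r] +
              values 2 f.1 ![x, y] ![p, A.N q, r] +
              values 2 f.1 ![x, y] ![p, q, A.N r])) -
            R.Q (R.Q (R.Q (values 2 f.1 ![x, y] ![p, q, r])))) := by
  have h₁ : delta A.br R.ρ 2 f.1 = 0 ↔ ∀ (x y z : ℂ) (p q r w : L),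
      delta A.br R.ρ 2 f.1 ![x, y, z] ![p, q, r, w] = 0 := by
    refine ⟨fun h => by simp [h], fun h => ?_⟩
    ext x p
    have hx : x = ![x 0, x 1, x 2] := by ext1 i; fin_cases i <;> rfl
    have hp : p = ![p 0, p 1, p 2, p 3] := by ext1 i; fin_cases i <;> rfl
    rw [hx, hp]
    exact h _ _ _ _ _ _ _
  have h₂ : (-1 : ℤ) ^ (1 + 2) • xi A.N R.Q 2 f.1 + dN A.br A.N R.ρ R.Q 1 g.1 = 0 ↔
      ∀ (x y : ℂ) (p q r : L), dN A.br A.N R.ρ R.Q 1 g.1 ![x, y] ![p, q, r] =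
        xi A.N R.Q 2 f.1 ![x, y] ![p, q, r] := by
    rw [Odd.neg_one_pow (by decide), neg_one_smul, neg_add_eq_zero]
    refine ⟨fun h => by simp [h], fun h => ?_⟩
    ext x p
    have hx : x = ![x 0, x 1] := by ext1 i; fin_cases i <;> rfl
    have hp : p = ![p 0, p 1, p 2] := by ext1 i; fin_cases i <;> rfl
    rw [hx, hp]
    exact (h _ _ _ _ _).symm
  have h₀ : (f, g) ∈ NLcocycles A R 1 ↔ delta A.br R.ρ 2 f.1 = 0 ∧
      (-1 : ℤ) ^ (1 + 2) • xi A.N R.Q 2 f.1 + dN A.br A.N R.ρ R.Q 1 g.1 = 0 :=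
    (LinearMap.mem_ker (M := NLCochain L M 1)).trans Prod.ext_iff
  have h₃ (x y : ℂ) (p q r : L) : dN A.br A.N R.ρ R.Q 1 g.1 ![x, y] ![p, q, r] =
      chevalleyEilenberg (fun Λ p => lam R.ρ Λ (A.N p)) (nijBracket A.br A.N) 1 g.1
          ![x, y] ![p, q, r] -
        R.Q (chevalleyEilenberg (fun Λ p => lam R.ρ Λ p) (fun x p q => lam A.br (.C x) p q) 1 g.1
          ![x, y] ![p, q, r]) := rfl
  rw [h₀, h₁, h₂]
  refine and_congr ?_ ?_
  · refine forall₄_congr fun x y z p => forall₃_congr fun q r w => ?_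
    rw [delta, chevalleyEilenberg_three, sub_eq_zero]
  · refine forall₄_congr fun x y p q => forall_congr' fun r => ?_
    rw [h₃, chevalleyEilenberg_two, chevalleyEilenberg_two, xi_three, lam_opProduct,
      lam_opProduct, sub_neg_eq_add, sub_neg_eq_add, Polynomial.C_add, ← sub_sub]

variable {A R}

lemma NLclass_eq_iff (u v : NLcocycles A R 1) :
    NLclass A R 0 u = NLclass A R 0 v ↔
      ∃ c, NLvalues 1 v.1 = NLvalues 1 u.1 + dNL A.br A.N R.ρ R.Q 0 c := by
  rw [eq_comm]
  refine (Submodule.Quotient.eq _).trans ?_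
  change (∃ c, _ = NLvalues 1 (v.1 - u.1)) ↔ _
  refine exists_congr fun c => ?_
  rw [map_sub, eq_sub_iff_add_eq', eq_comm]

variable (A R) in
/-- The triple given by `A`, `R` and the class of a cocycle. -/
def tripleOfCocycle (u : NLCochain L M 1) (hu : u ∈ NLcocycles A R 1) : NijenhuisTriple L M :=
  ⟨A, R, NLclass A R 0 ⟨u, hu⟩⟩

/-- Equality of triples, with the dependence of the representation on the algebra and of the class
on both removed: the underlying operations agree and the cocycles differ by a coboundary. -/
lemma tripleOfCocycle_eq_iff {A' : NijenhuisLCA L} {R' : NijenhuisRep A' M}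
    {u u' : NLCochain L M 1} (hu : u ∈ NLcocycles A R 1) (hu' : u' ∈ NLcocycles A' R' 1) :
    tripleOfCocycle A R u hu = tripleOfCocycle A' R' u' hu' ↔
      A.br = A'.br ∧ A.N = A'.N ∧ R.ρ = R'.ρ ∧ R.Q = R'.Q ∧
        ∃ c, NLvalues 1 u' = NLvalues 1 u + dNL A.br A.N R.ρ R.Q 0 c := by
  constructor
  · intro h
    obtain rfl : A = A' := congrArg Sigma.fst h
    obtain ⟨hR, hc⟩ := Sigma.mk.inj (eq_of_heq (Sigma.mk.inj h).2)
    subst hR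
    exact ⟨rfl, rfl, rfl, rfl, (NLclass_eq_iff _ _).1 (eq_of_heq hc)⟩
  · rintro ⟨h₁, h₂, h₃, h₄, hc⟩
    obtain rfl : A = A' := NijenhuisLCA.ext h₁ h₂
    obtain rfl : R = R' := NijenhuisRep.ext h₃ h₄
    have h := (NLclass_eq_iff ⟨u, hu⟩ ⟨u', hu'⟩).2 hc
    rw [tripleOfCocycle, h, tripleOfCocycle]

end Cocycles

/-! ### Skeletal algebras and cocycles -/

section Skeletal

variable {L₀ : Type*} [AddCommGroup L₀] [Module ℂ L₀] [Module ℂ[X] L₀] [IsScalarTower ℂ ℂ[X] L₀]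
  {L₁ : Type*} [AddCommGroup L₁] [Module ℂ L₁] [Module ℂ[X] L₁] [IsScalarTower ℂ ℂ[X] L₁]

namespace SkeletalNijenhuis

/-- The Nijenhuis Lie conformal algebra in degree `0`. -/
def toLCA (S : SkeletalNijenhuis L₀ L₁) : NijenhuisLCA L₀ where
  br := S.1.br₀₀
  sesq := S.1.sesq₀₀
  skew := S.1.skew₀₀
  jacobi x y p q r := by
    have h := S.1.d_l₃ x y p q r
    rw [S.2, LinearMap.zero_apply, sub_sub, eq_comm, sub_eq_zero] at h
    exact h
  N := S.1.N₀
  nij x p q := by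
    have h := S.1.d_N₂ x p q
    rw [S.2, LinearMap.zero_apply, eq_comm, sub_eq_zero] at h
    exact h.symm

/-- The Nijenhuis representation of the degree `0` part on the degree `1` part. -/
def toRep (S : SkeletalNijenhuis L₀ L₁) : NijenhuisRep (toLCA S) L₁ where
  ρ := S.1.br₀₁
  sesq := S.1.sesq₀₁
  rep x y p q m := by
    have h := S.1.l₃_d x y p q m
    rw [S.2, LinearMap.zero_apply, values_two_eq,
      MultilinearMap.map_coord_zero _ (2 : Fin 3) rfl, map_zero, sub_right_comm, eq_comm,
      sub_eq_zero] at h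
    exact h.symm
  Q := S.1.N₁
  nij x p m := by
    have h := S.1.N₂_d x p m
    rw [S.2, LinearMap.zero_apply, values_one_eq,
      MultilinearMap.map_coord_zero _ (1 : Fin 2) rfl, map_zero, eq_comm, sub_eq_zero] at h
    exact h.symm

lemma br₁₀_eq (S : SkeletalNijenhuis L₀ L₁) : S.1.br₁₀ = opProduct S.1.br₀₁ :=
  eq_opProduct S.1.skew₀₁

lemma mem_NLcocycles (S : SkeletalNijenhuis L₀ L₁) :
    (S.1.l₃, S.1.N₂) ∈ NLcocycles (toLCA S) (toRep S) 1 := by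
  refine (mem_NLcocycles_three_iff _ _ _ _).2 ⟨S.1.coherence, ?_⟩
  have h := S.1.N_coherence
  rw [br₁₀_eq] at h
  exact h

/-- The triple consisting of the two structures and the class of `(l₃, N₂)`. -/
def toTriple (S : SkeletalNijenhuis L₀ L₁) : NijenhuisTriple L₀ L₁ :=
  tripleOfCocycle (toLCA S) (toRep S) (S.1.l₃, S.1.N₂) (mem_NLcocycles S)

lemma toTriple_eq_iff (S S' : SkeletalNijenhuis L₀ L₁) :
    toTriple S = toTriple S' ↔ SkeletalEquiv S S' := by
  refine (tripleOfCocycle_eq_iff (mem_NLcocycles S) (mem_NLcocycles S')).trans ?_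
  rw [SkeletalEquiv, br₁₀_eq, br₁₀_eq]
  constructor
  · rintro ⟨h₁, h₂, h₃, h₄, hc⟩
    exact ⟨h₁, h₃, congrArg opProduct h₃, h₂, h₄, hc⟩
  · rintro ⟨h₁, h₃, -, h₂, h₄, hc⟩
    exact ⟨h₁, h₂, h₃, h₄, hc⟩

/-- The skeletal algebra with `d = 0` built from a 3-cocycle. -/
def ofCocycle (A : NijenhuisLCA L₀) (R : NijenhuisRep A L₁) (f : cochains L₀ L₁ 2)
    (g : cochains L₀ L₁ 1) (h : (f, g) ∈ NLcocycles A R 1) : SkeletalNijenhuis L₀ L₁ where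
  val :=
    { d := 0
      br₀₀ := A.br
      br₀₁ := R.ρ
      br₁₀ := opProduct R.ρ
      l₃ := f
      sesq₀₀ := A.sesq
      sesq₀₁ := R.sesq
      sesq₁₀ := R.sesq.opProduct
      skew₀₁ := fun x p m => by rw [lam_opProduct, neg_neg, sub_sub_cancel]
      skew₀₀ := A.skew
      d_br := fun x p m => by simp
      br_d := fun x m n => by simp
      d_l₃ := fun x y p q r => by
        rw [LinearMap.zero_apply, sub_sub, eq_comm, sub_eq_zero]
        exact A.jacobi x y p q r
      l₃_d := fun x y p q m => by
        rw [LinearMap.zero_apply, values_two_eq, MultilinearMap.map_coord_zero _ (2 : Fin 3) rfl,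
          map_zero, R.rep]
        abel
      coherence := ((mem_NLcocycles_three_iff A R f g).1 h).1
      N₀ := A.N
      N₁ := R.Q
      N₂ := g
      d_N₁ := fun m => by simp
      d_N₂ := fun x p q => by
        rw [LinearMap.zero_apply, eq_comm, sub_eq_zero]
        exact (A.nij x p q).symm
      N₂_d := fun x p m => by
        rw [LinearMap.zero_apply, values_one_eq, MultilinearMap.map_coord_zero _ (1 : Fin 2) rfl,
          map_zero, R.nij, sub_self]
      N_coherence := ((mem_NLcocycles_three_iff A R f g).1 h).2 }
  property := rfl

lemma toTriple_surjective : Function.Surjective (toTriple (L₀ := L₀) (L₁ := L₁)) := by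
  rintro ⟨A, R, c⟩
  obtain ⟨⟨⟨f, g⟩, h⟩, rfl⟩ := Submodule.mkQ_surjective _ c
  exact ⟨ofCocycle A R f g h, rfl⟩

end SkeletalNijenhuis

end Skeletal
end

theorem mainTheorem5
    (L₀ : Type*) [AddCommGroup L₀] [Module ℂ L₀] [Module ℂ[X] L₀] [IsScalarTower ℂ ℂ[X] L₀]
    (L₁ : Type*) [AddCommGroup L₁] [Module ℂ L₁] [Module ℂ[X] L₁] [IsScalarTower ℂ ℂ[X] L₁] :
    ∃ Φ : Quotient (skeletalSetoid L₀ L₁) ≃ NijenhuisTriple L₀ L₁,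
      ∀ S : SkeletalNijenhuis L₀ L₁,
        let T := Φ (Quotient.mk (skeletalSetoid L₀ L₁) S)
        T.1.br = S.1.br₀₀ ∧ T.1.N = S.1.N₀ ∧
        T.2.1.ρ = S.1.br₀₁ ∧ T.2.1.Q = S.1.N₁ ∧
        ∃ h : (S.1.l₃, S.1.N₂) ∈ NLcocycles T.1 T.2.1 1,
          T.2.2 = NLclass T.1 T.2.1 0 ⟨(S.1.l₃, S.1.N₂), h⟩ := by
  refine ⟨Equiv.ofBijective
    (Quotient.lift SkeletalNijenhuis.toTriple fun S S' h =>
      (SkeletalNijenhuis.toTriple_eq_iff S S').2 h) ⟨?_, ?_⟩, fun S =>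
        ⟨rfl, rfl, rfl, rfl, SkeletalNijenhuis.mem_NLcocycles S, rfl⟩⟩
  · rintro ⟨S⟩ ⟨S'⟩ h
    exact Quotient.sound ((SkeletalNijenhuis.toTriple_eq_iff S S').1 h)
  · intro T
    obtain ⟨S, hS⟩ := SkeletalNijenhuis.toTriple_surjective T
    exact ⟨Quotient.mk _ S, hS⟩
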